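/- Let $n\ge 1$ and let $H\subset\mathbb R^n$ be a Hanner polytope centered at the origin, that is, a full-dimensional polytope obtained, up to linear isomorphisms, from origin-symmetric line segments $[-a,a]\subset\mathbb R$, $a>0$, by finitely many applications of Cartesian products and of polarity $K\mapsto K^\circ=\{w:\langle w,x\rangle\le 1\ \text{for all } x\in K\}$. For a convex body $K\subset\mathbb R^n$ and distinct points $p,q$ in its interior, let $b$ be the point where the half-line from $p$ through $q$ meets $\partial K$, and let $d_K(p,q)=\log\frac{|pb|}{|qb|}$, $d_K(p,p)=0$, be the Funk distance. For $R>0$ let $B_K(R)=\{z\in\operatorname{int}K: d_K(0,z)\le R\}$ be the forward Funk ball about the origin (when $0\in\operatorname{int}K$). For a Borel set $U\subset \operatorname{int}K$ let $$\mathrm{vol}^{HT}_K(U)=\frac1{\omega_n}\int_U |(K-p)^\circ|\,dp$$ be its Holmes–Thompson volume, where $|\cdot|$ and $dp$ denote Lebesgue measure and $\omega_n$ is the volume of the $n$-dimensional Euclidean unit ball. Then, for every $R>0$ and with $\lambda=1-e^{-R}$, $$\mathrm{vol}^{HT}_H\big(B_H(R)\big)=\frac{2^n}{n!\,\omega_n}\left(\log\frac{1+\lambda}{1-\lambda}\right)^n=\frac{2^n}{n!\,\omega_n}\big(\log(2e^R-1)\big)^n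 .$$ -/

import Mathlib

open scoped ENNReal

noncomputable section

namespace Funk

/-- The polar body `K^p = (K - p)°` of `K ⊆ ℝⁿ` with respect to the point `p`; the dual of `ℝⁿ` is
identified with `ℝⁿ` through the standard dot product. The one-sided condition `≤ 1` is the right
one for bodies that are not symmetric about `p`. -/
def polarAt {n : ℕ} (K : Set (Fin n → ℝ)) (p : Fin n → ℝ) : Set (Fin n → ℝ) :=
  {w | ∀ x ∈ K, w ⬝ᵥ (x - p) ≤ 1}

/-- The Cartesian product `H × K ⊆ ℝᵐ⁺ⁿ` of `H ⊆ ℝᵐ` and `K ⊆ ℝⁿ`. -/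
def cartesianProduct {m n : ℕ} (H : Set (Fin m → ℝ)) (K : Set (Fin n → ℝ)) :
    Set (Fin (m + n) → ℝ) :=
  {z | (fun i : Fin m => z (Fin.castAdd n i)) ∈ H ∧ (fun j : Fin n => z (Fin.natAdd m j)) ∈ K}

/-- `IsHanner n H`: the set `H` is an `n`-dimensional Hanner polytope in `ℝⁿ` centered at the
origin, that is, `H` is built from centered nondegenerate line segments by Cartesian products and
polar bodies. The rule `linearImage` makes the notion independent of the choice of linear
coordinates on `ℝⁿ`. -/
inductive IsHanner : (n : ℕ) → Set (Fin n → ℝ) → Prop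
  | lineSegment (v : Fin 1 → ℝ) (hv : v ≠ 0) : IsHanner 1 (segment ℝ (-v) v)
  | product {m n : ℕ} {H : Set (Fin m → ℝ)} {K : Set (Fin n → ℝ)} :
      IsHanner m H → IsHanner n K → IsHanner (m + n) (cartesianProduct H K)
  | polar {n : ℕ} {H : Set (Fin n → ℝ)} : IsHanner n H → IsHanner n (polarAt H 0)
  | linearImage {n : ℕ} {H : Set (Fin n → ℝ)} (A : (Fin n → ℝ) ≃ₗ[ℝ] (Fin n → ℝ)) :
      IsHanner n H → IsHanner n (A '' H)

/-- For a convex body `K`, a point `p` in its interior and `v ≠ 0`, the unique `t > 0` such that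
`p + t v` lies on the boundary of `K` (so that the Funk norm of `v` at `p` is `1 / t`). -/
def exitTime {n : ℕ} (K : Set (Fin n → ℝ)) (p v : Fin n → ℝ) : ℝ :=
  sInf {t : ℝ | 0 < t ∧ p + t • v ∈ frontier K}

open Classical in
/-- The Funk distance `d_K(p, q) = log (pb / qb)`, where `b = p + t (q - p)` is the point at which
the half line from `p` through `q` meets the boundary of `K`; as `b - p = t (q - p)` and
`b - q = (t - 1) (q - p)`, the ratio `pb / qb` is `t / (t - 1)`. Moreover `d_K(p, p) = 0`. -/
def funkDist {n : ℕ} (K : Set (Fin n → ℝ)) (p q : Fin n → ℝ) : ℝ :=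
  if p = q then 0
  else Real.log (exitTime K p (q - p) / (exitTime K p (q - p) - 1))

/-- The forward Funk metric ball of radius `R` about `p`, in the Funk geometry on the interior
of `K`. -/
def funkBall {n : ℕ} (K : Set (Fin n → ℝ)) (p : Fin n → ℝ) (R : ℝ) : Set (Fin n → ℝ) :=
  {z | z ∈ interior K ∧ funkDist K p z ≤ R}

/-- `ω_n`, the Lebesgue volume of the Euclidean unit ball of `ℝⁿ`. -/
def omega (n : ℕ) : ℝ :=
  (MeasureTheory.volume (Metric.ball (0 : EuclideanSpace ℝ (Fin n)) 1)).toReal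

/-- The Holmes-Thompson volume `∫_U |K^p| / ω_n dp` of the Funk geometry of `K`. -/
def volHT {n : ℕ} (K U : Set (Fin n → ℝ)) : ℝ≥0∞ :=
  ∫⁻ p in U, MeasureTheory.volume (polarAt K p) / ENNReal.ofReal (omega n)

end Funk

end

/-! Write h_K for the support function. For p in K, slicing along the sublevel sets of h_K(w) -
⟨w,p⟩ gives n! |K^p| = ∫ exp(⟨w,p⟩ - h_K(w)) dw (`IsBody.factorial_mul_volume_polarAt`). Let F(K) be
the integral of this over p in λK (`ballIntegral`). The Funk ball about 0 is λK with λ = 1 - e^(-R)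
(`IsBody.funkBall_zero`), so its volume is F(K) / (n! ω_n).

F respects every Hanner operation. Support functions add over products, so F is multiplicative
(`ballIntegral_cartesianProduct`). Under a linear map the Jacobians in p and w cancel
(`IsBody.ballIntegral_image`). Slicing along h_K alone turns F(K) into an integral over r of ∫_K
∫_{K°} exp(rλ⟨x,p⟩), which is symmetric in K and K° (`IsBody.ballIntegral_polar`). Hence F(H) is the
n-th power of the value for a segment, 2 log((1+λ)/(1-λ)) (`IsHanner.ballIntegral_eq`). -/

namespace Funk

open MeasureTheory Set Filter
open scoped Topology Pointwise

variable {m n : ℕ}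

/-! ### Convex bodies, polarity and support functions -/

/-- A convex body with the origin in its interior. -/
structure IsBody (K : Set (Fin n → ℝ)) : Prop where
  convex : Convex ℝ K
  compact : IsCompact K
  mem_nhds : K ∈ 𝓝 0

theorem IsBody.zero_mem {K : Set (Fin n → ℝ)} (hK : IsBody K) : (0 : Fin n → ℝ) ∈ K :=
  mem_of_mem_nhds hK.mem_nhds

theorem mem_polar_iff {K : Set (Fin n → ℝ)} {w : Fin n → ℝ} :
    w ∈ polarAt K 0 ↔ ∀ x ∈ K, w ⬝ᵥ x ≤ 1 := by
  simp [polarAt]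

theorem continuous_dotProduct : Continuous fun q : (Fin n → ℝ) × (Fin n → ℝ) => q.1 ⬝ᵥ q.2 := by
  unfold dotProduct
  fun_prop

theorem convex_polar (K : Set (Fin n → ℝ)) : Convex ℝ (polarAt K 0) := by
  intro u hu v hv a b ha hb hab
  rw [mem_polar_iff] at *
  intro x hx
  rw [add_dotProduct, smul_dotProduct, smul_dotProduct, smul_eq_mul, smul_eq_mul]
  nlinarith [hu x hx, hv x hx]

theorem isClosed_polar (K : Set (Fin n → ℝ)) : IsClosed (polarAt K 0) := by
  have : polarAt K 0 = ⋂ x ∈ K, {w | w ⬝ᵥ x ≤ 1} := by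
    ext w
    simp [mem_polar_iff]
  rw [this]
  refine isClosed_biInter fun x _ => isClosed_le ?_ continuous_const
  exact continuous_dotProduct.comp (Continuous.prodMk_left x)

theorem IsBody.isBounded_polar {K : Set (Fin n → ℝ)} (hK : IsBody K) :
    Bornology.IsBounded (polarAt K 0) := by
  obtain ⟨ε, hε, hεK⟩ := Metric.nhds_basis_closedBall.mem_iff.1 hK.mem_nhds
  refine (Metric.isBounded_closedBall (x := (0 : Fin n → ℝ)) (r := 1 / ε)).subset fun w hw => ?_
  rw [mem_closedBall_zero_iff, pi_norm_le_iff_of_nonneg (by positivity)]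
  intro i
  -- Testing w against the points ±ε e_i of K bounds each coordinate by 1/ε.
  have key : ∀ c : ℝ, |c| ≤ ε → w i * c ≤ 1 := fun c hc => by
    have h := mem_polar_iff.1 hw (Pi.single i c) (hεK ?_)
    · simpa using h
    · rw [mem_closedBall_zero_iff, pi_norm_le_iff_of_nonneg hε.le]
      intro j
      by_cases hj : j = i
      · subst hj; simpa using hc
      · simp [hj, hε.le]
  have h1 := key ε (abs_of_pos hε).le
  have h2 := key (-ε) (by rw [abs_neg, abs_of_pos hε])
  rw [Real.norm_eq_abs, abs_le]
  constructor
  · rw [neg_le, le_div_iff₀ hε]; linarith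
  · rw [le_div_iff₀ hε]; linarith

theorem IsBody.polar {K : Set (Fin n → ℝ)} (hK : IsBody K) : IsBody (polarAt K 0) where
  convex := convex_polar K
  compact := Metric.isCompact_of_isClosed_isBounded (isClosed_polar K) hK.isBounded_polar
  mem_nhds := by
    -- The inequality holds near each (0, x); compactness of K makes the neighbourhood of 0 uniform
    -- in x.
    have := hK.compact.eventually_forall_of_forall_eventually
      (x₀ := (0 : Fin n → ℝ)) (P := fun w x => w ⬝ᵥ x ≤ 1) fun x _ => by
        have h : Tendsto (fun q : (Fin n → ℝ) × (Fin n → ℝ) => q.1 ⬝ᵥ q.2) (𝓝 (0, x)) (𝓝 0) := by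
          have := (continuous_dotProduct (n := n)).tendsto (0, x)
          simpa using this
        exact h.eventually (ge_mem_nhds one_pos)
    filter_upwards [this] with w hw
    exact mem_polar_iff.2 hw

/-- The bipolar theorem. -/
theorem IsBody.polar_polar {K : Set (Fin n → ℝ)} (hK : IsBody K) :
    polarAt (polarAt K 0) 0 = K := by
  apply Subset.antisymm
  · intro x hx
    by_contra hxK
    obtain ⟨f, u, hf, hu⟩ :=
      geometric_hahn_banach_closed_point hK.convex hK.compact.isClosed hxK
    have hu0 : 0 < u := by simpa using hf 0 hK.zero_mem
    -- w represents the separating functional f; since f < u on K and u > 0, w/u lies in the polar,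
    -- while ⟨w/u, x⟩ > 1.
    set w : Fin n → ℝ := fun i => f (Pi.single i 1)
    have hw : ∀ y, w ⬝ᵥ y = f y := fun y => by
      have := LinearMap.pi_apply_eq_sum_univ (f : (Fin n → ℝ) →ₗ[ℝ] ℝ) y
      simp only [ContinuousLinearMap.coe_coe] at this
      rw [this]
      simp only [dotProduct, smul_eq_mul, w, mul_comm]
      refine Finset.sum_congr rfl fun i _ => ?_
      congr 2
      ext j
      simp [Pi.single_apply, eq_comm]
    have h := mem_polar_iff.1 hx (u⁻¹ • w) (mem_polar_iff.2 fun y hy => by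
      rw [smul_dotProduct, hw, smul_eq_mul, inv_mul_le_iff₀ hu0, mul_one]
      exact (hf y hy).le)
    rw [dotProduct_smul, dotProduct_comm, hw, smul_eq_mul, inv_mul_le_iff₀ hu0, mul_one] at h
    linarith
  · intro x hx
    rw [mem_polar_iff]
    intro w hw
    rw [dotProduct_comm]
    exact mem_polar_iff.1 hw x hx

/-- The support function `w ↦ sup {w ⬝ᵥ x | x ∈ K}` of a convex body `K` around the origin,
as the Minkowski functional of its polar body. -/
noncomputable def supportFun (K : Set (Fin n → ℝ)) (w : Fin n → ℝ) : ℝ := gauge (polarAt K 0) w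

theorem supportFun_nonneg (K : Set (Fin n → ℝ)) (w : Fin n → ℝ) : 0 ≤ supportFun K w :=
  gauge_nonneg w

theorem supportFun_smul (K : Set (Fin n → ℝ)) (w : Fin n → ℝ) {r : ℝ} (hr : 0 ≤ r) :
    supportFun K (r • w) = r * supportFun K w :=
  gauge_smul_of_nonneg hr w

theorem IsBody.continuous_supportFun {K : Set (Fin n → ℝ)} (hK : IsBody K) :
    Continuous (supportFun K) :=
  continuous_gauge hK.polar.convex hK.polar.mem_nhds

theorem IsBody.gauge_le_iff {K : Set (Fin n → ℝ)} (hK : IsBody K) {x : Fin n → ℝ} {r : ℝ}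
    (hr : 0 < r) : gauge K x ≤ r ↔ x ∈ r • K := by
  rw [mem_smul_set_iff_inv_smul_mem₀ hr.ne', ← hK.compact.isClosed.closure_eq,
    ← gauge_le_one_iff_mem_closure hK.convex hK.mem_nhds, hK.compact.isClosed.closure_eq,
    gauge_smul_of_nonneg (inv_nonneg.2 hr.le), smul_eq_mul, inv_mul_le_iff₀ hr, mul_one]

/-- The gauge of the polar scales directly only for positive r. All other r follow by approximation
from above, both sides forcing r ≥ 0. -/
theorem IsBody.supportFun_le_iff {K : Set (Fin n → ℝ)} (hK : IsBody K) {w : Fin n → ℝ} {r : ℝ} :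
    supportFun K w ≤ r ↔ ∀ x ∈ K, w ⬝ᵥ x ≤ r := by
  have pos : ∀ s : ℝ, 0 < s → (supportFun K w ≤ s ↔ ∀ x ∈ K, w ⬝ᵥ x ≤ s) := fun s hs => by
    rw [supportFun, hK.polar.gauge_le_iff hs, mem_smul_set_iff_inv_smul_mem₀ hs.ne', mem_polar_iff]
    simp only [smul_dotProduct, smul_eq_mul, inv_mul_le_iff₀ hs, mul_one]
  constructor
  · intro h x hx
    refine le_of_forall_gt_imp_ge_of_dense fun s hs => ?_
    exact (pos s (((supportFun_nonneg K w).trans h).trans_lt hs)).1 (h.trans hs.le) x hx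
  · intro h
    have hr : 0 ≤ r := by simpa using h 0 hK.zero_mem
    refine le_of_forall_gt_imp_ge_of_dense fun s hs => ?_
    exact (pos s (hr.trans_lt hs)).2 fun x hx => (h x hx).trans hs.le

theorem IsBody.dotProduct_le_supportFun {K : Set (Fin n → ℝ)} (hK : IsBody K)
    {x : Fin n → ℝ} (hx : x ∈ K) (w : Fin n → ℝ) : w ⬝ᵥ x ≤ supportFun K w :=
  hK.supportFun_le_iff.1 le_rfl x hx

/-- Exhibits the polar about p as a sublevel set of a function positively homogeneous in w, the form
needed for slicing. -/
theorem IsBody.mem_polarAt_iff {K : Set (Fin n → ℝ)} (hK : IsBody K) {p w : Fin n → ℝ} :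
    w ∈ polarAt K p ↔ supportFun K w - w ⬝ᵥ p ≤ 1 := by
  rw [sub_le_iff_le_add, hK.supportFun_le_iff]
  simp [polarAt, dotProduct_sub]

theorem IsBody.mem_polar_iff_supportFun_le {K : Set (Fin n → ℝ)} (hK : IsBody K)
    {w : Fin n → ℝ} : w ∈ polarAt K 0 ↔ supportFun K w ≤ 1 := by
  simp [hK.mem_polarAt_iff]

/-! ### Products, linear images and segments -/

/-- The coordinate splitting `ℝᵐ⁺ⁿ → ℝᵐ × ℝⁿ`. -/
def splitCoords (m n : ℕ) (z : Fin (m + n) → ℝ) : (Fin m → ℝ) × (Fin n → ℝ) :=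
  (fun i => z (Fin.castAdd n i), fun j => z (Fin.natAdd m j))

theorem continuous_splitCoords : Continuous (splitCoords m n) := by
  unfold splitCoords
  fun_prop

theorem splitCoords_append (x : Fin m → ℝ) (y : Fin n → ℝ) :
    splitCoords m n (Fin.append x y) = (x, y) := by
  simp [splitCoords]

theorem append_splitCoords (z : Fin (m + n) → ℝ) :
    Fin.append (splitCoords m n z).1 (splitCoords m n z).2 = z :=
  Fin.append_castAdd_natAdd

theorem continuous_append :
    Continuous fun q : (Fin m → ℝ) × (Fin n → ℝ) => (Fin.append q.1 q.2 : Fin (m + n) → ℝ) := by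
  refine continuous_pi fun i => ?_
  refine Fin.addCases (fun j => ?_) (fun j => ?_) i
  · simp only [Fin.append_left]; fun_prop
  · simp only [Fin.append_right]; fun_prop

/-- The coordinate splitting as a homeomorphism. -/
def splitHomeomorph (m n : ℕ) : (Fin (m + n) → ℝ) ≃ₜ (Fin m → ℝ) × (Fin n → ℝ) where
  toFun := splitCoords m n
  invFun q := Fin.append q.1 q.2
  left_inv := append_splitCoords
  right_inv q := splitCoords_append q.1 q.2
  continuous_toFun := continuous_splitCoords
  continuous_invFun := continuous_append

theorem cartesianProduct_eq_preimage (H : Set (Fin m → ℝ)) (K : Set (Fin n → ℝ)) :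
    cartesianProduct H K = splitCoords m n ⁻¹' (H ×ˢ K) := rfl

theorem dotProduct_eq_splitCoords (w z : Fin (m + n) → ℝ) :
    w ⬝ᵥ z = (splitCoords m n w).1 ⬝ᵥ (splitCoords m n z).1 +
      (splitCoords m n w).2 ⬝ᵥ (splitCoords m n z).2 := by
  simp [dotProduct, splitCoords, Fin.sum_univ_add]

theorem IsBody.cartesianProduct {H : Set (Fin m → ℝ)} {K : Set (Fin n → ℝ)} (hH : IsBody H)
    (hK : IsBody K) : IsBody (cartesianProduct H K) where
  convex := fun _ hx _ hy _ _ ha hb hab =>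
    ⟨hH.convex hx.1 hy.1 ha hb hab, hK.convex hx.2 hy.2 ha hb hab⟩
  compact := by
    rw [cartesianProduct_eq_preimage]
    exact (splitHomeomorph m n).isCompact_preimage.2 (hH.compact.prod hK.compact)
  mem_nhds := by
    rw [cartesianProduct_eq_preimage]
    exact continuous_splitCoords.continuousAt.preimage_mem_nhds
      (prod_mem_nhds hH.mem_nhds hK.mem_nhds)

theorem supportFun_cartesianProduct {H : Set (Fin m → ℝ)} {K : Set (Fin n → ℝ)} (hH : IsBody H)
    (hK : IsBody K) (w : Fin (m + n) → ℝ) :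
    supportFun (cartesianProduct H K) w =
      supportFun H (splitCoords m n w).1 + supportFun K (splitCoords m n w).2 := by
  -- Equality of suprema is checked by comparing their upper bounds.
  refine eq_of_forall_ge_iff fun r => ?_
  rw [(hH.cartesianProduct hK).supportFun_le_iff, ← le_sub_iff_add_le, hH.supportFun_le_iff]
  constructor
  · intro h x hx
    rw [le_sub_comm, hK.supportFun_le_iff]
    intro y hy
    have := h (Fin.append x y) (by
      rw [cartesianProduct_eq_preimage, mem_preimage, splitCoords_append]
      exact ⟨hx, hy⟩)
    rw [dotProduct_eq_splitCoords, splitCoords_append] at this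
    exact le_sub_iff_add_le'.2 this
  · intro h z hz
    rw [dotProduct_eq_splitCoords]
    have h1 := h (splitCoords m n z).1 hz.1
    have h2 : _ ⬝ᵥ (splitCoords m n z).2 ≤ _ :=
      hK.dotProduct_le_supportFun hz.2 (splitCoords m n w).2
    linarith

theorem IsBody.image {K : Set (Fin n → ℝ)} (hK : IsBody K)
    (A : (Fin n → ℝ) ≃ₗ[ℝ] (Fin n → ℝ)) : IsBody (A '' K) where
  convex := hK.convex.linear_image A.toLinearMap
  compact := hK.compact.image A.toContinuousLinearEquiv.continuous
  mem_nhds := by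
    have := A.toContinuousLinearEquiv.toHomeomorph.isOpenMap.image_mem_nhds hK.mem_nhds
    simpa using this

/-- The transpose of a linear endomorphism of `ℝⁿ`. -/
noncomputable def transposeMap (A : (Fin n → ℝ) →ₗ[ℝ] (Fin n → ℝ)) :
    (Fin n → ℝ) →ₗ[ℝ] (Fin n → ℝ) :=
  Matrix.toLin' (LinearMap.toMatrix' A).transpose

theorem transposeMap_dotProduct (A : (Fin n → ℝ) →ₗ[ℝ] (Fin n → ℝ)) (w x : Fin n → ℝ) :
    transposeMap A w ⬝ᵥ x = w ⬝ᵥ A x := by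
  conv_rhs => rw [← LinearMap.toMatrix'_mulVec A x]
  rw [transposeMap, Matrix.toLin'_apply, Matrix.mulVec_transpose, Matrix.dotProduct_mulVec]

theorem det_transposeMap (A : (Fin n → ℝ) →ₗ[ℝ] (Fin n → ℝ)) :
    LinearMap.det (transposeMap A) = LinearMap.det A := by
  rw [transposeMap, LinearMap.det_toLin', Matrix.det_transpose, LinearMap.det_toMatrix']

theorem supportFun_image {K : Set (Fin n → ℝ)} (hK : IsBody K)
    (A : (Fin n → ℝ) ≃ₗ[ℝ] (Fin n → ℝ)) (w : Fin n → ℝ) :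
    supportFun (A '' K) w = supportFun K (transposeMap A.toLinearMap w) := by
  refine eq_of_forall_ge_iff fun r => ?_
  rw [(hK.image A).supportFun_le_iff, hK.supportFun_le_iff]
  simp [transposeMap_dotProduct]

theorem isBody_segment {v : Fin 1 → ℝ} (hv : v ≠ 0) : IsBody (segment ℝ (-v) v) where
  convex := convex_segment _ _
  compact := by
    rw [segment_eq_image_lineMap]
    exact isCompact_Icc.image (by fun_prop)
  mem_nhds := by
    have hv0 : v 0 ≠ 0 := fun h => hv (by ext i; fin_cases i; exact h)
    have h : {x : Fin 1 → ℝ | |x 0 / v 0| < 1} ∈ 𝓝 0 := by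
      refine IsOpen.mem_nhds (isOpen_lt (by fun_prop) continuous_const) (by simp)
    filter_upwards [h] with x hx
    have hx : |x 0 / v 0| < 1 := hx
    rw [abs_lt] at hx
    refine ⟨(1 - x 0 / v 0) / 2, (1 + x 0 / v 0) / 2, by linarith, by linarith, by ring, ?_⟩
    ext i
    fin_cases i
    simp
    field_simp
    ring

/-! ### Changes of variables and slicing -/

theorem lintegral_eq_abs_det_mul_lintegral_comp {A : (Fin n → ℝ) →ₗ[ℝ] (Fin n → ℝ)}
    (hA : LinearMap.det A ≠ 0) {f : (Fin n → ℝ) → ℝ≥0∞} (hf : Measurable f) :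
    ∫⁻ x, f x = ENNReal.ofReal |LinearMap.det A| * ∫⁻ x, f (A x) := by
  rw [← lintegral_map hf A.continuous_of_finiteDimensional.measurable,
    Measure.map_linearMap_addHaar_eq_smul_addHaar volume hA, lintegral_smul_measure, smul_eq_mul,
    ← mul_assoc, ← ENNReal.ofReal_mul (abs_nonneg _), ← abs_mul, mul_inv_cancel₀ hA]
  simp

theorem lintegral_eq_pow_mul_lintegral_comp_smul {r : ℝ} (hr : 0 < r)
    {f : (Fin n → ℝ) → ℝ≥0∞} (hf : Measurable f) :
    ∫⁻ x, f x = ENNReal.ofReal (r ^ n) * ∫⁻ x, f (r • x) := by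
  have hdet : LinearMap.det (r • (LinearMap.id : (Fin n → ℝ) →ₗ[ℝ] (Fin n → ℝ))) = r ^ n := by
    simp
  have h := lintegral_eq_abs_det_mul_lintegral_comp
    (A := r • (LinearMap.id : (Fin n → ℝ) →ₗ[ℝ] (Fin n → ℝ))) (by rw [hdet]; positivity) hf
  rw [hdet, abs_of_pos (by positivity)] at h
  simpa using h

theorem setLIntegral_smul_set {r : ℝ} (hr : 0 < r) {K : Set (Fin n → ℝ)} (hK : MeasurableSet K)
    {f : (Fin n → ℝ) → ℝ≥0∞} (hf : Measurable f) :
    ∫⁻ x in r • K, f x = ENNReal.ofReal (r ^ n) * ∫⁻ x in K, f (r • x) := by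
  rw [← lintegral_indicator (hK.const_smul₀ r), ← lintegral_indicator hK,
    lintegral_eq_pow_mul_lintegral_comp_smul hr (hf.indicator (hK.const_smul₀ r))]
  congr 2
  ext x
  have hx : r • x ∈ r • K ↔ x ∈ K := smul_mem_smul_set_iff₀ hr.ne' K x
  by_cases h : x ∈ K
  · rw [indicator_of_mem h, indicator_of_mem (hx.2 h)]
  · rw [indicator_of_notMem h, indicator_of_notMem (mt hx.1 h)]

/-- Layer-cake form of e^(-t) = ∫_t^∞ e^(-r) dr; the hypothesis on t keeps [t, ∞) inside [0, ∞). -/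
theorem lintegral_exp_neg_indicator {t : ℝ} (ht : 0 ≤ t) :
    ∫⁻ r in Ioi (0 : ℝ), {r | t ≤ r}.indicator (fun r => ENNReal.ofReal (Real.exp (-r))) r =
      ENNReal.ofReal (Real.exp (-t)) := by
  have h : (Ici t ∩ Ioi 0 : Set ℝ) =ᵐ[volume] Ioi t := by
    have h1 : Ioi t = Ioi t ∩ Ioi 0 := by
      ext r; simp only [mem_Ioi, mem_inter_iff]; exact ⟨fun h => ⟨h, ht.trans_lt h⟩, And.left⟩
    rw [h1]
    exact Ioi_ae_eq_Ici.symm.inter (ae_eq_refl _)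
  change ∫⁻ r in Ioi (0 : ℝ), (Ici t).indicator _ r = _
  rw [lintegral_indicator measurableSet_Ici, Measure.restrict_restrict measurableSet_Ici,
    Measure.restrict_congr_set h, ← ofReal_integral_eq_lintegral_ofReal (integrableOn_exp_neg_Ioi t)
      (ae_of_all _ fun _ => (Real.exp_pos _).le), integral_exp_neg_Ioi]

theorem lintegral_pow_mul_exp_neg (n : ℕ) :
    ∫⁻ r in Ioi (0 : ℝ), ENNReal.ofReal (r ^ n * Real.exp (-r)) = n.factorial := by
  have hpos : (0 : ℝ) < n + 1 := by positivity
  have heq : ∀ r ∈ Ioi (0 : ℝ), Real.exp (-r) * r ^ ((n : ℝ) + 1 - 1) = r ^ n * Real.exp (-r) :=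
    fun r _ => by rw [add_sub_cancel_right, Real.rpow_natCast, mul_comm]
  have hint := (integrableOn_congr_fun heq measurableSet_Ioi).1 (Real.GammaIntegral_convergent hpos)
  rw [← ofReal_integral_eq_lintegral_ofReal hint, ← setIntegral_congr_fun measurableSet_Ioi heq,
    ← Real.Gamma_eq_integral hpos, Real.Gamma_nat_eq_factorial, ENNReal.ofReal_natCast]
  exact (ae_restrict_iff' measurableSet_Ioi).2 (ae_of_all _ fun r hr =>
    mul_nonneg (pow_nonneg (le_of_lt hr) n) (Real.exp_pos _).le)

/-- Integration against `exp (-h)` for a positively homogeneous `h ≥ 0`, by slicing along the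
sublevel sets of `h`. -/
theorem lintegral_exp_neg_mul {h : (Fin n → ℝ) → ℝ} (hmeas : Measurable h) (hnn : ∀ w, 0 ≤ h w)
    (hhom : ∀ (r : ℝ) w, 0 < r → h (r • w) = r * h w) {g : (Fin n → ℝ) → ℝ≥0∞}
    (hg : Measurable g) :
    ∫⁻ w, ENNReal.ofReal (Real.exp (-h w)) * g w =
      ∫⁻ r in Ioi (0 : ℝ), ENNReal.ofReal (r ^ n * Real.exp (-r)) *
        ∫⁻ x in {x | h x ≤ 1}, g (r • x) := by
  have hS : MeasurableSet {q : (Fin n → ℝ) × ℝ | h q.1 ≤ q.2} :=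
    measurableSet_le (hmeas.comp measurable_fst) measurable_snd
  have hF : Measurable fun q : (Fin n → ℝ) × ℝ =>
      {q : (Fin n → ℝ) × ℝ | h q.1 ≤ q.2}.indicator
        (fun q => ENNReal.ofReal (Real.exp (-q.2))) q * g q.1 :=
    (Measurable.indicator (by fun_prop) hS).mul (hg.comp measurable_fst)
  calc ∫⁻ w, ENNReal.ofReal (Real.exp (-h w)) * g w
      = ∫⁻ w, ∫⁻ r in Ioi (0 : ℝ), {q : (Fin n → ℝ) × ℝ | h q.1 ≤ q.2}.indicator
        (fun q => ENNReal.ofReal (Real.exp (-q.2))) (w, r) * g w := by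
        refine lintegral_congr fun w => ?_
        have hm : Measurable fun r => {q : (Fin n → ℝ) × ℝ | h q.1 ≤ q.2}.indicator
            (fun q => ENNReal.ofReal (Real.exp (-q.2))) (w, r) :=
          (Measurable.indicator (by fun_prop) hS).comp measurable_prodMk_left
        rw [lintegral_mul_const _ hm, ← lintegral_exp_neg_indicator (hnn w)]
        rfl
    _ = ∫⁻ r in Ioi (0 : ℝ), ∫⁻ w, {q : (Fin n → ℝ) × ℝ | h q.1 ≤ q.2}.indicator
        (fun q => ENNReal.ofReal (Real.exp (-q.2))) (w, r) * g w :=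
        lintegral_lintegral_swap hF.aemeasurable
    _ = _ := by
        refine setLIntegral_congr_fun measurableSet_Ioi fun r hr => ?_
        have hr : 0 < r := hr
        have hm : Measurable fun w => {q : (Fin n → ℝ) × ℝ | h q.1 ≤ q.2}.indicator
            (fun q => ENNReal.ofReal (Real.exp (-q.2))) (w, r) * g w :=
          hF.comp measurable_prodMk_right
        -- Substituting w = r x maps {h ≤ 1} onto {h ≤ r}, with Jacobian r^n.
        rw [lintegral_eq_pow_mul_lintegral_comp_smul hr hm,
          ENNReal.ofReal_mul (by positivity), mul_assoc]
        congr 1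
        have hS1 : MeasurableSet {x | h x ≤ 1} := measurableSet_le hmeas measurable_const
        rw [← lintegral_indicator hS1, ← lintegral_const_mul' _ _ ENNReal.ofReal_ne_top]
        refine lintegral_congr fun x => ?_
        have : h (r • x) ≤ r ↔ h x ≤ 1 := by
          rw [hhom r x hr, mul_le_iff_le_one_right hr]
        simp only [indicator, mem_ofPred_eq, this]
        split_ifs <;> simp

/-! ### Exponential integrals and polar volumes -/

/-- The integral of `w ↦ exp (⟨w, p⟩ - h_K(w))`, which is `n!` times the volume of the polar body
of `K` with respect to `p`. -/
noncomputable def expIntegral (K : Set (Fin n → ℝ)) (p : Fin n → ℝ) : ℝ≥0∞ :=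
  ∫⁻ w, ENNReal.ofReal (Real.exp (w ⬝ᵥ p - supportFun K w))

theorem IsBody.measurable_expKernel {K : Set (Fin n → ℝ)} (hK : IsBody K) :
    Measurable fun q : (Fin n → ℝ) × (Fin n → ℝ) =>
      ENNReal.ofReal (Real.exp (q.2 ⬝ᵥ q.1 - supportFun K q.2)) := by
  have h1 := (continuous_dotProduct (n := n)).comp continuous_swap
  have h2 := hK.continuous_supportFun.comp (continuous_snd (X := Fin n → ℝ))
  exact (Real.continuous_exp.comp (h1.sub h2)).measurable.ennreal_ofReal

theorem IsBody.measurable_expIntegral {K : Set (Fin n → ℝ)} (hK : IsBody K) :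
    Measurable (expIntegral K) :=
  hK.measurable_expKernel.lintegral_prod_right'

/-- Slicing with g = 1; membership of p in K is what makes h_K(w) - ⟨w,p⟩ nonnegative, and n! is the
resulting Gamma integral. -/
theorem IsBody.factorial_mul_volume_polarAt {K : Set (Fin n → ℝ)} (hK : IsBody K)
    {p : Fin n → ℝ} (hp : p ∈ K) :
    n.factorial * volume (polarAt K p) = expIntegral K p := by
  have hc : Continuous fun w : Fin n → ℝ => w ⬝ᵥ p :=
    continuous_dotProduct.comp (Continuous.prodMk_left p)
  have h := lintegral_exp_neg_mul (h := fun w => supportFun K w - w ⬝ᵥ p) (g := fun _ => 1)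
    (hK.continuous_supportFun.sub hc).measurable
    (fun w => sub_nonneg.2 (hK.dotProduct_le_supportFun hp w))
    (fun r w hr => by
      simp only [supportFun_smul K w hr.le, smul_dotProduct, smul_eq_mul, mul_sub])
    measurable_const
  have hset : {w | supportFun K w - w ⬝ᵥ p ≤ 1} = polarAt K p := by
    ext w
    exact hK.mem_polarAt_iff.symm
  simp only [neg_sub, mul_one, hset, lintegral_one, Measure.restrict_apply_univ] at h
  rw [expIntegral, h, lintegral_mul_const _ (by fun_prop), lintegral_pow_mul_exp_neg]

/-- Up to the factor `n! * ω_n`, the Holmes-Thompson volume of `lam • K` in the Funk geometry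
of `K`. -/
noncomputable def ballIntegral (K : Set (Fin n → ℝ)) (lam : ℝ) : ℝ≥0∞ :=
  ∫⁻ p in lam • K, expIntegral K p

theorem IsBody.smul_subset {K : Set (Fin n → ℝ)} (hK : IsBody K) {lam : ℝ} (h0 : 0 ≤ lam)
    (h1 : lam ≤ 1) : lam • K ⊆ K := by
  rintro _ ⟨x, hx, rfl⟩
  exact hK.convex.smul_mem_of_zero_mem hK.zero_mem hx ⟨h0, h1⟩

theorem IsBody.measurableSet {K : Set (Fin n → ℝ)} (hK : IsBody K) : MeasurableSet K :=
  hK.compact.measurableSet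

theorem IsBody.factorial_mul_lintegral_volume_polarAt {K : Set (Fin n → ℝ)} (hK : IsBody K)
    {lam : ℝ} (h0 : 0 ≤ lam) (h1 : lam ≤ 1) :
    n.factorial * ∫⁻ p in lam • K, volume (polarAt K p) = ballIntegral K lam := by
  rw [ballIntegral, ← lintegral_const_mul' _ _ (ENNReal.natCast_ne_top _)]
  exact setLIntegral_congr_fun (hK.measurableSet.const_smul₀ lam) fun p hp =>
    hK.factorial_mul_volume_polarAt (hK.smul_subset h0 h1 hp)

/-- The same slicing with exp ⟨w,p⟩ left as weight: the slices are now multiples of K°, independent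
of p. -/
theorem IsBody.expIntegral_eq {K : Set (Fin n → ℝ)} (hK : IsBody K) (p : Fin n → ℝ) :
    expIntegral K p = ∫⁻ r in Ioi (0 : ℝ), ENNReal.ofReal (r ^ n * Real.exp (-r)) *
      ∫⁻ x in polarAt K 0, ENNReal.ofReal (Real.exp (r * (x ⬝ᵥ p))) := by
  have hc : Continuous fun w : Fin n → ℝ => w ⬝ᵥ p :=
    continuous_dotProduct.comp (Continuous.prodMk_left p)
  have h := lintegral_exp_neg_mul (h := supportFun K)
    (g := fun w => ENNReal.ofReal (Real.exp (w ⬝ᵥ p)))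
    hK.continuous_supportFun.measurable (supportFun_nonneg K)
    (fun r w hr => supportFun_smul K w hr.le)
    (Real.continuous_exp.comp hc).measurable.ennreal_ofReal
  have hset : {w | supportFun K w ≤ 1} = polarAt K 0 := by
    ext w
    exact hK.mem_polar_iff_supportFun_le.symm
  simp only [hset, smul_dotProduct, smul_eq_mul] at h
  rw [expIntegral, ← h]
  refine lintegral_congr fun w => ?_
  rw [← ENNReal.ofReal_mul (Real.exp_pos _).le, ← Real.exp_add]
  ring_nf

theorem IsBody.ballIntegral_eq {K : Set (Fin n → ℝ)} (hK : IsBody K) {lam : ℝ} (h0 : 0 < lam) :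
    ballIntegral K lam = ENNReal.ofReal (lam ^ n) *
      ∫⁻ r in Ioi (0 : ℝ), ENNReal.ofReal (r ^ n * Real.exp (-r)) *
        ∫⁻ p in K, ∫⁻ x in polarAt K 0, ENNReal.ofReal (Real.exp (r * lam * (x ⬝ᵥ p))) := by
  have hmeas : Measurable fun q : ((Fin n → ℝ) × ℝ) × (Fin n → ℝ) =>
      ENNReal.ofReal (Real.exp (q.1.2 * lam * (q.2 ⬝ᵥ q.1.1))) := by
    have : Continuous fun q : ((Fin n → ℝ) × ℝ) × (Fin n → ℝ) => q.2 ⬝ᵥ q.1.1 :=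
      continuous_dotProduct.comp (continuous_snd.prodMk (continuous_fst.comp continuous_fst))
    exact (by fun_prop : Continuous fun q : ((Fin n → ℝ) × ℝ) × (Fin n → ℝ) =>
      Real.exp (q.1.2 * lam * (q.2 ⬝ᵥ q.1.1))).measurable.ennreal_ofReal
  have hinner : Measurable fun q : (Fin n → ℝ) × ℝ =>
      ∫⁻ x in polarAt K 0, ENNReal.ofReal (Real.exp (q.2 * lam * (x ⬝ᵥ q.1))) :=
    hmeas.lintegral_prod_right'
  rw [ballIntegral, setLIntegral_smul_set h0 hK.measurableSet hK.measurable_expIntegral]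
  congr 1
  simp only [hK.expIntegral_eq, dotProduct_smul, smul_eq_mul, ← mul_assoc]
  rw [lintegral_lintegral_swap]
  · refine lintegral_congr fun r => ?_
    exact lintegral_const_mul _ (hinner.comp measurable_prodMk_right)
  · exact (Measurable.mul (by fun_prop) hinner).aemeasurable

/-! ### Behaviour under polarity, linear maps and products -/

/-- By the bipolar theorem, passing to the polar only swaps the two domains of the double integral;
Tonelli and symmetry of the pairing restore it. -/
theorem IsBody.ballIntegral_polar {K : Set (Fin n → ℝ)} (hK : IsBody K) {lam : ℝ}
    (h0 : 0 < lam) : ballIntegral (polarAt K 0) lam = ballIntegral K lam := by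
  rw [hK.polar.ballIntegral_eq h0, hK.ballIntegral_eq h0, hK.polar_polar]
  congr 1
  refine lintegral_congr fun r => ?_
  congr 1
  rw [lintegral_lintegral_swap]
  · simp only [dotProduct_comm]
  · have : Continuous fun q : (Fin n → ℝ) × (Fin n → ℝ) => q.2 ⬝ᵥ q.1 :=
      continuous_dotProduct.comp continuous_swap
    exact (by fun_prop : Continuous fun q : (Fin n → ℝ) × (Fin n → ℝ) =>
      Real.exp (r * lam * (q.2 ⬝ᵥ q.1))).measurable.ennreal_ofReal.aemeasurable

theorem IsBody.ballIntegral_image {K : Set (Fin n → ℝ)} (hK : IsBody K)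
    (A : (Fin n → ℝ) ≃ₗ[ℝ] (Fin n → ℝ)) (lam : ℝ) :
    ballIntegral (A '' K) lam = ballIntegral K lam := by
  have hdet : LinearMap.det A.toLinearMap ≠ 0 := A.isUnit_det'.ne_zero
  -- The substitution w ↦ Aᵀw in the inner integral supplies the factor |det A| that p ↦ A p
  -- produces in the outer one.
  have hexp : ∀ p, ENNReal.ofReal |LinearMap.det A.toLinearMap| * expIntegral (A '' K) (A p) =
      expIntegral K p := fun p => by
    have hm : Measurable fun w : Fin n → ℝ =>
        ENNReal.ofReal (Real.exp (w ⬝ᵥ p - supportFun K w)) := by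
      have hc : Continuous fun w : Fin n → ℝ => w ⬝ᵥ p :=
        continuous_dotProduct.comp (Continuous.prodMk_left p)
      exact (Real.continuous_exp.comp (hc.sub hK.continuous_supportFun)).measurable.ennreal_ofReal
    have h := lintegral_eq_abs_det_mul_lintegral_comp
      (A := transposeMap A.toLinearMap) (by rwa [det_transposeMap]) hm
    rw [det_transposeMap] at h
    refine Eq.trans ?_ h.symm
    simp only [expIntegral, supportFun_image hK, transposeMap_dotProduct, LinearEquiv.coe_coe]
  have hS := (hK.image A).measurableSet.const_smul₀ lam
  have h := lintegral_eq_abs_det_mul_lintegral_comp hdet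
    ((hK.image A).measurable_expIntegral.indicator hS)
  rw [lintegral_indicator hS] at h
  refine h.trans ?_
  rw [ballIntegral, ← lintegral_indicator (hK.measurableSet.const_smul₀ lam),
    ← lintegral_const_mul']
  · refine lintegral_congr fun p => ?_
    have hmem : A p ∈ lam • (A '' K) ↔ p ∈ lam • K := by
      rw [← image_smul_set, A.injective.mem_set_image]
    by_cases hp : p ∈ lam • K
    · rw [LinearEquiv.coe_coe, indicator_of_mem hp, indicator_of_mem (hmem.2 hp), hexp]
    · rw [LinearEquiv.coe_coe, indicator_of_notMem hp, indicator_of_notMem (mt hmem.1 hp),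
        mul_zero]
  · exact ENNReal.ofReal_ne_top

theorem measurePreserving_splitCoords :
    MeasurePreserving (splitHomeomorph m n).toMeasurableEquiv volume volume := by
  have h1 := volume_measurePreserving_piCongrLeft (fun _ : Fin (m + n) => ℝ) finSumFinEquiv
  have h2 := volume_measurePreserving_sumPiEquivProdPi (fun _ : Fin m ⊕ Fin n => ℝ)
  exact h2.comp h1.symm

theorem setLIntegral_cartesianProduct_mul (S : Set (Fin m → ℝ)) (T : Set (Fin n → ℝ))
    {f : (Fin m → ℝ) → ℝ≥0∞} {g : (Fin n → ℝ) → ℝ≥0∞} (hf : Measurable f) (hg : Measurable g) :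
    ∫⁻ z in cartesianProduct S T, f (splitCoords m n z).1 * g (splitCoords m n z).2 =
      (∫⁻ x in S, f x) * ∫⁻ y in T, g y := by
  rw [← lintegral_prod_mul hf.aemeasurable hg.aemeasurable, Measure.prod_restrict]
  exact measurePreserving_splitCoords.setLIntegral_comp_preimage_emb
    (splitHomeomorph m n).toMeasurableEquiv.measurableEmbedding
    (fun q => f q.1 * g q.2) (S ×ˢ T)

theorem expIntegral_cartesianProduct {H : Set (Fin m → ℝ)} {K : Set (Fin n → ℝ)}
    (hH : IsBody H) (hK : IsBody K) (z : Fin (m + n) → ℝ) :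
    expIntegral (cartesianProduct H K) z =
      expIntegral H (splitCoords m n z).1 * expIntegral K (splitCoords m n z).2 := by
  have h := setLIntegral_cartesianProduct_mul univ univ
    (hH.measurable_expKernel.comp (measurable_prodMk_left (x := (splitCoords m n z).1)))
    (hK.measurable_expKernel.comp (measurable_prodMk_left (x := (splitCoords m n z).2)))
  have huniv : cartesianProduct (univ : Set (Fin m → ℝ)) (univ : Set (Fin n → ℝ)) = univ := by
    simp [cartesianProduct]
  rw [huniv] at h
  simp only [Measure.restrict_univ, Function.comp_apply] at h
  rw [expIntegral, expIntegral, expIntegral, ← h]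
  refine lintegral_congr fun w => ?_
  rw [← ENNReal.ofReal_mul (Real.exp_pos _).le, ← Real.exp_add,
    supportFun_cartesianProduct hH hK, dotProduct_eq_splitCoords]
  ring_nf

theorem smul_cartesianProduct {lam : ℝ} (h0 : lam ≠ 0) (H : Set (Fin m → ℝ))
    (K : Set (Fin n → ℝ)) :
    lam • cartesianProduct H K = cartesianProduct (lam • H) (lam • K) := by
  ext z
  simp only [cartesianProduct, mem_ofPred_eq, mem_smul_set_iff_inv_smul_mem₀ h0]
  rfl

theorem ballIntegral_cartesianProduct {H : Set (Fin m → ℝ)} {K : Set (Fin n → ℝ)}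
    (hH : IsBody H) (hK : IsBody K) {lam : ℝ} (h0 : lam ≠ 0) :
    ballIntegral (cartesianProduct H K) lam = ballIntegral H lam * ballIntegral K lam := by
  rw [ballIntegral, smul_cartesianProduct h0]
  simp only [expIntegral_cartesianProduct hH hK]
  exact setLIntegral_cartesianProduct_mul _ _ hH.measurable_expIntegral hK.measurable_expIntegral

/-! ### The segment -/

theorem lintegral_Icc_inv_add_inv {lam : ℝ} (h0 : 0 < lam) (h1 : lam < 1) :
    ∫⁻ x in Icc (-lam) lam, ENNReal.ofReal ((1 - x)⁻¹ + (1 + x)⁻¹) =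
      ENNReal.ofReal (2 * Real.log ((1 + lam) / (1 - lam))) := by
  have hne : ∀ x ∈ Icc (-lam) lam, 0 < 1 - x ∧ 0 < 1 + x := fun x hx =>
    ⟨by linarith [hx.2], by linarith [hx.1]⟩
  have hcont : ContinuousOn (fun x : ℝ => (1 - x)⁻¹ + (1 + x)⁻¹) (Icc (-lam) lam) :=
    ((continuousOn_const.sub continuousOn_id).inv₀ fun x hx => (hne x hx).1.ne').add
      ((continuousOn_const.add continuousOn_id).inv₀ fun x hx => (hne x hx).2.ne')
  rw [← ofReal_integral_eq_lintegral_ofReal hcont.integrableOn_Icc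
    ((ae_restrict_iff' measurableSet_Icc).2 (ae_of_all _ fun x hx =>
      (add_pos (inv_pos.2 (hne x hx).1) (inv_pos.2 (hne x hx).2)).le)),
    integral_Icc_eq_integral_Ioc, ← intervalIntegral.integral_of_le (by linarith)]
  have huIcc : uIcc (-lam) lam = Icc (-lam) lam := uIcc_of_le (by linarith)
  rw [intervalIntegral.integral_eq_sub_of_hasDerivAt
    (f := fun x => Real.log (1 + x) - Real.log (1 - x))]
  · rw [Real.log_div (by linarith) (by linarith)]
    congr 1
    simp only [sub_neg_eq_add, ← sub_eq_add_neg]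
    ring
  · intro x hx
    rw [huIcc] at hx
    have hd1 := ((hasDerivAt_id x).const_add 1).log (hne x hx).2.ne'
    have hd2 := ((hasDerivAt_id x).const_sub 1).log (hne x hx).1.ne'
    convert! hd1.sub hd2 using 1
    simp only [id]
    ring
  · exact ContinuousOn.intervalIntegrable (by rwa [huIcc])

theorem mem_unitSegment_iff {x : Fin 1 → ℝ} :
    x ∈ segment ℝ (-1 : Fin 1 → ℝ) 1 ↔ x 0 ∈ Icc (-1 : ℝ) 1 := by
  constructor
  · rintro ⟨a, b, ha, hb, hab, rfl⟩
    simp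
    constructor <;> linarith
  · rintro ⟨h1, h2⟩
    refine ⟨(1 - x 0) / 2, (1 + x 0) / 2, by linarith, by linarith, by ring, ?_⟩
    ext i
    fin_cases i
    simp
    ring

theorem volume_polarAt_unitSegment {p : Fin 1 → ℝ} (h1 : 0 < 1 - p 0) (h2 : 0 < 1 + p 0) :
    volume (polarAt (segment ℝ (-1 : Fin 1 → ℝ) 1) p) =
      ENNReal.ofReal ((1 - p 0)⁻¹ + (1 + p 0)⁻¹) := by
  have hset : polarAt (segment ℝ (-1 : Fin 1 → ℝ) 1) p =
      MeasurableEquiv.funUnique (Fin 1) ℝ ⁻¹' Icc (-(1 + p 0)⁻¹) (1 - p 0)⁻¹ := by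
    ext w
    simp only [polarAt, mem_ofPred_eq, mem_unitSegment_iff, mem_preimage,
      MeasurableEquiv.funUnique_apply, dotProduct, Finset.univ_unique, Fin.default_eq_zero,
      Finset.sum_singleton, Pi.sub_apply, mem_Icc, neg_le]
    rw [← one_div, ← one_div, le_div_iff₀ h1, le_div_iff₀ h2]
    constructor
    · intro h
      have ha := h (-1) (by simp)
      have hb := h 1 (by simp)
      simp only [Pi.neg_apply, Pi.one_apply] at ha hb
      constructor <;> linarith
    · rintro ⟨ha, hb⟩ x ⟨hx1, hx2⟩
      -- w(x - p) is monotone in x, so the sign of w selects the endpoint where the constraint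
      -- binds.
      rcases le_total 0 (w 0) with hw | hw <;> nlinarith
  rw [hset, ← sub_neg_eq_add (1 - p 0)⁻¹, ← Real.volume_Icc]
  exact (volume_preserving_funUnique (Fin 1) ℝ).measure_preimage
    measurableSet_Icc.nullMeasurableSet

theorem ballIntegral_unitSegment {lam : ℝ} (h0 : 0 < lam) (h1 : lam < 1) :
    ballIntegral (segment ℝ (-1 : Fin 1 → ℝ) 1) lam =
      ENNReal.ofReal (2 * Real.log ((1 + lam) / (1 - lam))) := by
  have hset : lam • segment ℝ (-1 : Fin 1 → ℝ) 1 =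
      MeasurableEquiv.funUnique (Fin 1) ℝ ⁻¹' Icc (-lam) lam := by
    ext p
    rw [mem_smul_set_iff_inv_smul_mem₀ h0.ne', mem_unitSegment_iff]
    simp only [Pi.smul_apply, smul_eq_mul, mem_Icc, mem_preimage,
      MeasurableEquiv.funUnique_apply, Fin.default_eq_zero]
    rw [inv_mul_le_iff₀ h0, le_inv_mul_iff₀ h0]
    simp
  have hbody : IsBody (segment ℝ (-1 : Fin 1 → ℝ) 1) := isBody_segment one_ne_zero
  rw [← hbody.factorial_mul_lintegral_volume_polarAt h0.le h1.le, Nat.factorial_one,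
    Nat.cast_one, one_mul, ← lintegral_Icc_inv_add_inv h0 h1,
    ← (volume_preserving_funUnique (Fin 1) ℝ).setLIntegral_comp_preimage_emb
      (MeasurableEquiv.measurableEmbedding _), ← hset]
  refine setLIntegral_congr_fun (hbody.measurableSet.const_smul₀ lam) fun p hp => ?_
  rw [hset] at hp
  have hp : p 0 ∈ Icc (-lam) lam := hp
  exact volume_polarAt_unitSegment (by linarith [hp.2]) (by linarith [hp.1])

/-- Scaling by the possibly negative number `v 0` reduces to [-1, 1] by linear invariance. -/
theorem ballIntegral_segment {v : Fin 1 → ℝ} (hv : v ≠ 0) {lam : ℝ} (h0 : 0 < lam)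
    (h1 : lam < 1) :
    ballIntegral (segment ℝ (-v) v) lam =
      ENNReal.ofReal (2 * Real.log ((1 + lam) / (1 - lam))) := by
  have hv0 : v 0 ≠ 0 := fun h => hv (by ext i; fin_cases i; exact h)
  have himage : segment ℝ (-v) v =
      LinearEquiv.smulOfNeZero ℝ (Fin 1 → ℝ) (v 0) hv0 '' segment ℝ (-1 : Fin 1 → ℝ) 1 := by
    have h : LinearEquiv.smulOfNeZero ℝ (Fin 1 → ℝ) (v 0) hv0 1 = v := by
      ext i
      fin_cases i
      simp
    have := image_segment ℝ
      (LinearEquiv.smulOfNeZero ℝ (Fin 1 → ℝ) (v 0) hv0).toLinearMap.toAffineMap (-1) 1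
    simp only [LinearMap.coe_toAffineMap, LinearEquiv.coe_coe, map_neg, h] at this
    exact this.symm
  rw [himage, (isBody_segment one_ne_zero).ballIntegral_image, ballIntegral_unitSegment h0 h1]

/-! ### Induction over Hanner polytopes -/

theorem IsHanner.isBody {H : Set (Fin n → ℝ)} (hH : IsHanner n H) : IsBody H := by
  induction hH with
  | lineSegment v hv => exact isBody_segment hv
  | product _ _ h1 h2 => exact h1.cartesianProduct h2
  | polar _ h => exact h.polar
  | linearImage A _ h => exact h.image A

theorem IsHanner.ballIntegral_eq {H : Set (Fin n → ℝ)} (hH : IsHanner n H) {lam : ℝ}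
    (h0 : 0 < lam) (h1 : lam < 1) :
    ballIntegral H lam = ENNReal.ofReal (2 * Real.log ((1 + lam) / (1 - lam))) ^ n := by
  induction hH with
  | lineSegment v hv => rw [ballIntegral_segment hv h0 h1, pow_one]
  | product hH hK ihH ihK =>
    rw [ballIntegral_cartesianProduct hH.isBody hK.isBody h0.ne', ihH, ihK, pow_add]
  | polar hH ih => rw [hH.isBody.ballIntegral_polar h0, ih]
  | linearImage A hH ih => rw [hH.isBody.ballIntegral_image, ih]

/-! ### Funk balls about the origin and the final formula -/

theorem IsBody.exitTime_zero {K : Set (Fin n → ℝ)} (hK : IsBody K) {z : Fin n → ℝ}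
    (hz : 0 < gauge K z) : exitTime K 0 z = (gauge K z)⁻¹ := by
  have hset : {t : ℝ | 0 < t ∧ 0 + t • z ∈ frontier K} = {(gauge K z)⁻¹} := by
    ext t
    rw [mem_ofPred_eq, mem_singleton_iff, zero_add,
      ← gauge_eq_one_iff_mem_frontier hK.convex hK.mem_nhds]
    constructor
    · rintro ⟨ht, h⟩
      rw [gauge_smul_of_nonneg ht.le, smul_eq_mul] at h
      exact eq_inv_of_mul_eq_one_left h
    · rintro rfl
      refine ⟨inv_pos.2 hz, ?_⟩
      rw [gauge_smul_of_nonneg (inv_nonneg.2 hz.le), smul_eq_mul, inv_mul_cancel₀ hz.ne']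
  rw [exitTime, hset, csInf_singleton]

/-- With g the gauge of z, the exit time is t = 1/g, and t/(t-1) = 1/(1-g). Points outside the
interior are covered by the conventions for division and `Real.log`. -/
theorem IsBody.funkDist_zero {K : Set (Fin n → ℝ)} (hK : IsBody K) (z : Fin n → ℝ) :
    funkDist K 0 z = -Real.log (1 - gauge K z) := by
  rcases eq_or_ne 0 z with rfl | hz
  · simp [funkDist]
  have hg : 0 < gauge K z := (gauge_pos (absorbent_nhds_zero hK.mem_nhds)
    (NormedSpace.isVonNBounded_of_isBounded ℝ hK.compact.isBounded)).2 hz.symm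
  rw [funkDist, if_neg hz, sub_zero, hK.exitTime_zero hg, ← Real.log_inv]
  congr 1
  rw [show (gauge K z)⁻¹ - 1 = (gauge K z)⁻¹ * (1 - gauge K z) by field_simp, ← div_div,
    div_self (inv_ne_zero hg.ne'), one_div]

theorem IsBody.funkBall_zero {K : Set (Fin n → ℝ)} (hK : IsBody K) {R : ℝ} (hR : 0 < R) :
    funkBall K 0 R = (1 - Real.exp (-R)) • K := by
  have hexp : Real.exp (-R) < 1 := by simpa using hR
  ext z
  rw [← hK.gauge_le_iff (by linarith), funkBall, mem_ofPred_eq, hK.funkDist_zero,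
    ← gauge_lt_one_iff_mem_interior hK.convex hK.mem_nhds]
  constructor
  · rintro ⟨h1, h2⟩
    have := (Real.le_log_iff_exp_le (by linarith)).1 (neg_le.1 h2)
    linarith
  · intro h
    -- Interiority is automatic here, since λ < 1.
    have h1 : gauge K z < 1 := by linarith [Real.exp_pos (-R)]
    exact ⟨h1, neg_le.1 ((Real.le_log_iff_exp_le (by linarith)).2 (by linarith))⟩

theorem omega_pos (n : ℕ) : 0 < omega n :=
  ENNReal.toReal_pos (Metric.measure_ball_pos _ _ one_pos).ne' measure_ball_lt_top.ne

theorem IsHanner.volHT_smul {H : Set (Fin n → ℝ)} (hH : IsHanner n H) {lam : ℝ} (h0 : 0 < lam)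
    (h1 : lam < 1) :
    volHT H (lam • H) = ENNReal.ofReal (2 ^ n / ((n.factorial : ℝ) * omega n) *
      (Real.log ((1 + lam) / (1 - lam))) ^ n) := by
  have hlog : 0 ≤ Real.log ((1 + lam) / (1 - lam)) :=
    Real.log_nonneg ((one_le_div (by linarith)).2 (by linarith))
  have hω := omega_pos n
  have hfac : (0 : ℝ) < n.factorial := by exact_mod_cast n.factorial_pos
  have hint := hH.isBody.factorial_mul_lintegral_volume_polarAt h0.le h1.le
  rw [hH.ballIntegral_eq h0 h1, ← ENNReal.ofReal_pow (by positivity),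
    ← ENNReal.eq_div_iff (by exact_mod_cast n.factorial_ne_zero)
      (ENNReal.natCast_ne_top _)] at hint
  simp only [volHT, div_eq_mul_inv]
  rw [lintegral_mul_const' _ _ (ENNReal.inv_ne_top.2 (ENNReal.ofReal_pos.2 hω).ne'), hint,
    ← ENNReal.ofReal_natCast, ← ENNReal.ofReal_div_of_pos hfac, ← div_eq_mul_inv,
    ← ENNReal.ofReal_div_of_pos hω]
  congr 1
  field_simp
  ring

end Funk

theorem lemma3p4 (n : ℕ) (H : Set (Fin n → ℝ)) (hH : Funk.IsHanner n H)
    (R : ℝ) (hR : 0 < R) (lam : ℝ) (hlam : lam = 1 - Real.exp (-R)) :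
    Funk.volHT H (Funk.funkBall H 0 R) =
        ENNReal.ofReal (2 ^ n / ((n.factorial : ℝ) * Funk.omega n) *
          (Real.log ((1 + lam) / (1 - lam))) ^ n) ∧
      Funk.volHT H (Funk.funkBall H 0 R) =
        ENNReal.ofReal (2 ^ n / ((n.factorial : ℝ) * Funk.omega n) *
          (Real.log (2 * Real.exp R - 1)) ^ n) := by
  have hexp : Real.exp (-R) < 1 := by simpa using hR
  have hpos := Real.exp_pos (-R)
  have hratio : (1 + lam) / (1 - lam) = 2 * Real.exp R - 1 := by
    rw [hlam, div_eq_iff (by linarith), Real.exp_neg]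
    have := Real.exp_pos R
    field_simp
    ring
  have hvol : Funk.volHT H (Funk.funkBall H 0 R) =
      ENNReal.ofReal (2 ^ n / ((n.factorial : ℝ) * Funk.omega n) *
        (Real.log ((1 + lam) / (1 - lam))) ^ n) := by
    rw [hH.isBody.funkBall_zero hR, ← hlam]
    exact hH.volHT_smul (by linarith) (by linarith)
  exact ⟨hvol, hratio ▸ hvol⟩
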